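/- Let $Q_5$ be the $5$-dimensional hypercube graph (vertices: binary strings of length $5$; two strings are adjacent when they differ in exactly one coordinate), and let $FQ_5$ be the $5$-dimensional folded cube graph (the Kummer graph), obtained from $Q_5$ by adding an edge between every vertex and its opposite vertex, the one that differs from it in all coordinates. For a finite connected simple graph $G$, a scramble $\mathcal S$ on $G$ is a collection of non-empty vertex sets, called eggs, each inducing a connected subgraph. Let $h(\mathcal S)$ be the minimum size of a vertex set that meets every egg, and let $e(\mathcal S)$ be the minimum of $|E(A,A^c)|$ over all $A\subseteq V(G)$ such that $A$ and $A^c$ each contain an egg ($e(\mathcal S)=\infty$ if there is no such $A$). The order of $\mathcal S$ is $\|\mathcal S\|=\min(h(\mathcal S),e(\mathcal S))$, and the scramble number $\mathrm{sn}(G)$ is the maximum order of a scramble on $G$. Let $\mathcal E_k$ be the scramble whose eggs are all connected vertex sets with exactly $k$ vertices. A divisor on $G$ is a function $D:V(G)\to\mathbb Z$; its degree is $\sum_v D(v)$, and it is effective if $D\ge 0$. The chip-firing move at $v$ decreases $D(v)$ by the degree of $v$ and increases $D(w)$ by $1$ for every neighbour $w$ of $v$; two divisors are equivalent if one can be transformed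 into the other by a finite sequence of chip-firing moves. The rank of $D$ is $-1$ if $D$ is not equivalent to an effective divisor; otherwise it is the largest $r\ge 0$ such that $D-E$ is equivalent to an effective divisor for every effective divisor $E$ of degree $r$. The gonality $\mathrm{gon}(G)$ is the minimum degree of a divisor of positive rank. Theorem. The scramble $\mathcal E_6$ on $Q_5$ has order $\|\mathcal E_6\|=16$. Moreover, $$\mathrm{sn}(Q_5)=\mathrm{gon}(Q_5)=16\qquad\text{and}\qquad \mathrm{sn}(FQ_5)=\mathrm{gon}(FQ_5)=16 .$$ -/

import Mathlib

namespace SimpleGraph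

/-! ### Hypercubes and folded cubes -/

/-- The `n`-dimensional hypercube graph: binary strings of length `n`, two of them adjacent
when they differ in exactly one coordinate. -/
def hypercube (n : ℕ) : SimpleGraph (Fin n → Bool) where
  Adj x y := hammingDist x y = 1
  symm := ⟨fun x y h => by rw [hammingDist_comm]; exact h⟩
  loopless := ⟨fun x h => by simp at h⟩

instance (n : ℕ) : DecidableRel (hypercube n).Adj :=
  fun x y => inferInstanceAs (Decidable (hammingDist x y = 1))

/-- The `n`-dimensional folded cube graph: the hypercube together with all edges that join a
vertex to its opposite vertex. (For `n = 5` this is the Kummer graph. For `n ≥ 2` no added edge is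
parallel to an old one.) -/
def foldedCube (n : ℕ) : SimpleGraph (Fin n → Bool) :=
  hypercube n ⊔ SimpleGraph.fromRel (fun x y => y = fun i => !(x i))

instance (n : ℕ) : DecidableRel (foldedCube n).Adj :=
  fun x y => inferInstanceAs (Decidable (hammingDist x y = 1 ∨
    (x ≠ y ∧ ((y = fun i => !(x i)) ∨ (x = fun i => !(y i))))))

/-! ### Scrambles -/

/-- A scramble on `G`: a collection of connected (in particular nonempty) vertex sets,
called eggs. -/
structure Scramble {V : Type*} (G : SimpleGraph V) where
  eggs : Set (Finset V)
  connected : ∀ E ∈ eggs, (G.induce (E : Set V)).Connected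

namespace Scramble

variable {V : Type*} {G : SimpleGraph V}

/-- A hitting set meets every egg. -/
def IsHittingSet [DecidableEq V] (S : G.Scramble) (C : Finset V) : Prop :=
  ∀ E ∈ S.eggs, (C ∩ E).Nonempty

/-- An egg-cut is a vertex set such that it and its complement each contain an egg. -/
def IsEggCut [Fintype V] [DecidableEq V] (S : G.Scramble) (A : Finset V) : Prop :=
  (∃ E ∈ S.eggs, E ⊆ A) ∧ (∃ E ∈ S.eggs, E ⊆ Aᶜ)

/-- `h(S)`: the minimum size of a hitting set. -/
noncomputable def hittingNumber [DecidableEq V] (S : G.Scramble) : ℕ∞ :=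
  ⨅ (C : Finset V) (_ : S.IsHittingSet C), (C.card : ℕ∞)

/-- `e(S)`: the minimum number of edges between `A` and `Aᶜ` over all egg-cuts `A`
(`⊤` if there is no egg-cut). -/
noncomputable def eggCutNumber [Fintype V] [DecidableEq V] [DecidableRel G.Adj]
    (S : G.Scramble) : ℕ∞ :=
  ⨅ (A : Finset V) (_ : S.IsEggCut A), ((G.interedges A Aᶜ).card : ℕ∞)

/-- The order `‖S‖ = min (h(S), e(S))` of a scramble. -/
noncomputable def order [Fintype V] [DecidableEq V] [DecidableRel G.Adj]
    (S : G.Scramble) : ℕ∞ :=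
  min S.hittingNumber S.eggCutNumber

end Scramble

/-- The `k`-uniform scramble: the eggs are all connected vertex sets with exactly `k` elements. -/
def uniformScramble {V : Type*} (G : SimpleGraph V) (k : ℕ) : G.Scramble where
  eggs := {E | E.card = k ∧ (G.induce (E : Set V)).Connected}
  connected := fun _ h => h.2

/-- The scramble number: the maximum order of a scramble on `G`. -/
noncomputable def scrambleNumber {V : Type*} (G : SimpleGraph V) [Fintype V] [DecidableEq V]
    [DecidableRel G.Adj] : ℕ∞ :=
  ⨆ S : G.Scramble, S.order

/-! ### Divisors, chip-firing and gonality

A divisor on a finite graph with vertex set `V` is a function `V → ℤ`. -/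

section Divisors

variable {V : Type*} [Fintype V]

/-- The degree of a divisor. -/
def divisorDegree (D : V → ℤ) : ℤ := ∑ v, D v

variable [DecidableEq V] (G : SimpleGraph V) [DecidableRel G.Adj]

/-- The chip-firing move at `v`: it removes `deg v` chips from `v` and gives one chip
to each neighbour of `v`. -/
def fire (v : V) (D : V → ℤ) : V → ℤ := fun w =>
  if w = v then D v - G.degree v else D w + (if G.Adj v w then 1 else 0)

/-- `D` can be transformed into `D'` by a finite sequence of chip-firing moves. -/
def DivisorEquiv (D D' : V → ℤ) : Prop :=
  Relation.ReflTransGen (fun D₁ D₂ => ∃ v, D₂ = G.fire v D₁) D D'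

/-- `D` is equivalent to some effective divisor. -/
def IsWinnable (D : V → ℤ) : Prop :=
  ∃ F : V → ℤ, 0 ≤ F ∧ G.DivisorEquiv D F

open Classical in
/-- The rank of a divisor: `-1` if it is not equivalent to an effective divisor, and otherwise the
maximum `r ≥ 0` such that `D - E` is equivalent to an effective divisor for every effective
divisor `E` of degree `r`. -/
noncomputable def divisorRank (D : V → ℤ) : ℤ :=
  if G.IsWinnable D then
    ((sSup {r : ℕ | ∀ E : V → ℤ, 0 ≤ E → divisorDegree E = r → G.IsWinnable (D - E)} : ℕ) : ℤ)
  else -1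

/-- The (divisorial) gonality: the minimum degree of a divisor of positive rank. -/
noncomputable def gonality : ℤ :=
  sInf {d : ℤ | ∃ D : V → ℤ, 0 < G.divisorRank D ∧ divisorDegree D = d}

end Divisors

end SimpleGraph

/-! Everything is squeezed between a scramble of order 16 and a divisor of degree 16, using sn ≤
gon. Upper bound: every edge of either graph flips an odd number of coordinates, so both graphs are
bipartite by parity. One chip on each even vertex has positive rank: firing all vertices except an
odd `v` only moves chips from neighbours of `v` to `v` (`divisorRank_pos_of_isIndepSet`). The
inequality sn ≤ gon (`order_le_divisorDegree`): take an effective divisor hitting as many eggs as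
possible in its class. Either its support is a hitting set, or moving towards a divisor that hits a
missed egg must lose another egg at some legal set-firing; that firing set is an egg-cut whose edges
are paid for by chips (`exists_isEggCut`). Lower bound: for six-vertex eggs in the 5-cube, egg-cuts
have at least 16 edges by edge isoperimetry (`sixteen_le_cubeBoundary`), and a set with no connected
six-subset misses at least 16 vertices (`NoClump.sixteen_le`, a pruned search). Adding edges does
not lower the scramble number, so the bound passes to the folded cube. -/

namespace SimpleGraph

/-! ### The Laplacian, chip-firing and rank. -/

section Laplacian

variable {V : Type*} [Fintype V] (G : SimpleGraph V) [DecidableRel G.Adj]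

/-- The graph Laplacian applied to an integer function. -/
def lap (f : V → ℤ) : V → ℤ := fun v => ∑ w, if G.Adj v w then f v - f w else 0

lemma lap_zero : G.lap 0 = 0 := by
  funext v; simp [lap]

lemma lap_add (f g : V → ℤ) : G.lap (f + g) = G.lap f + G.lap g := by
  funext v
  simp only [lap, Pi.add_apply, ← Finset.sum_add_distrib]
  refine Finset.sum_congr rfl fun w _ => ?_
  split_ifs <;> ring

lemma lap_sub (f g : V → ℤ) : G.lap (f - g) = G.lap f - G.lap g := by
  rw [eq_sub_iff_add_eq, ← lap_add, sub_add_cancel]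

lemma lap_sub_const (f : V → ℤ) (c : ℤ) : G.lap (fun v => f v - c) = G.lap f := by
  funext v; simp [lap]

lemma sum_lap (f : V → ℤ) : ∑ v, G.lap f v = 0 := by
  have h : ∑ v, G.lap f v = -∑ v, G.lap f v := by
    conv_lhs => simp only [lap]
    rw [Finset.sum_comm]
    simp only [lap, ← Finset.sum_neg_distrib]
    refine Finset.sum_congr rfl fun v _ => Finset.sum_congr rfl fun w _ => ?_
    simp only [G.adj_comm w v]
    split_ifs <;> ring
  omega

lemma divisorDegree_sub_lap (D f : V → ℤ) : divisorDegree (D - G.lap f) = divisorDegree D := by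
  simp [divisorDegree, Finset.sum_sub_distrib, sum_lap]

lemma lap_indicator_nonpos [DecidableEq V] (U : Finset V) {v : V} (hv : v ∉ U) :
    G.lap (fun w => if w ∈ U then 1 else 0) v ≤ 0 := by
  refine Finset.sum_nonpos fun w _ => ?_
  simp only [hv, if_false]
  split_ifs <;> simp

lemma lap_indicator_lt [DecidableEq V] (U : Finset V) {v w : V} (hv : v ∉ U) (hw : w ∈ U)
    (h : G.Adj v w) : G.lap (fun w => if w ∈ U then 1 else 0) v < 0 := by
  refine Finset.sum_neg' (fun x _ => ?_) ⟨w, Finset.mem_univ _, ?_⟩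
  · simp only [hv, if_false]
    split_ifs <;> simp
  · simp [hv, hw, h]

lemma lap_indicator_eq [DecidableEq V] (U : Finset V) {v : V} (hv : v ∈ U) :
    G.lap (fun w => if w ∈ U then 1 else 0) v = ((Uᶜ.filter (G.Adj v)).card : ℤ) := by
  rw [← Finset.sum_boole, lap, ← Finset.sum_subset (Finset.subset_univ Uᶜ)]
  · refine Finset.sum_congr rfl fun w hw => ?_
    simp [hv, Finset.mem_compl.1 hw]
  · intro w _ hw
    simp [hv, Finset.notMem_compl.1 hw]

variable [DecidableEq V]

lemma fire_eq (v : V) (D : V → ℤ) : G.fire v D = D - G.lap (Pi.single v 1) := by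
  funext w
  simp only [fire, Pi.sub_apply, lap]
  split_ifs with h
  · subst h
    rw [← card_neighborFinset_eq_degree, neighborFinset_eq_filter, Finset.card_filter]
    push_cast
    congr 1
    refine Finset.sum_congr rfl fun u _ => ?_
    split_ifs with hu
    · simp [hu.ne.symm]
    · rfl
  all_goals
    rw [Finset.sum_eq_single v]
    · simp_all [G.adj_comm]
    · intro u _ hu
      simp [h, hu]
    · simp

lemma exists_lap_of_divisorEquiv {D D' : V → ℤ} (h : G.DivisorEquiv D D') :
    ∃ f, D' = D - G.lap f := by
  induction h with
  | refl => exact ⟨0, by simp [lap_zero]⟩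
  | tail _ h ih =>
    obtain ⟨f, rfl⟩ := ih
    obtain ⟨v, rfl⟩ := h
    exact ⟨f + Pi.single v 1, by rw [fire_eq, lap_add]; abel⟩

/-- Fire the vertices of `U` once each, in any order; debts along the way are allowed. -/
lemma divisorEquiv_sub_lap_indicator (D : V → ℤ) (U : Finset V) :
    G.DivisorEquiv D (D - G.lap (fun w => if w ∈ U then 1 else 0)) := by
  induction U using Finset.induction_on with
  | empty =>
    have : G.lap (fun w => if w ∈ (∅ : Finset V) then 1 else 0) = 0 := by
      simp only [Finset.notMem_empty, if_false]
      exact G.lap_zero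
    rw [this, sub_zero]
    exact Relation.ReflTransGen.refl
  | insert v U hv ih =>
    refine ih.tail ⟨v, ?_⟩
    have : (fun w => if w ∈ insert v U then (1 : ℤ) else 0)
        = (fun w => if w ∈ U then (1 : ℤ) else 0) + Pi.single v 1 := by
      funext w
      by_cases h : w = v
      · subst h; simp [hv]
      · simp [h]
    rw [fire_eq, this, lap_add, sub_sub]

lemma IsWinnable.divisorDegree_nonneg {G : SimpleGraph V} [DecidableRel G.Adj] {D : V → ℤ}
    (h : G.IsWinnable D) : 0 ≤ divisorDegree D := by
  obtain ⟨F, hF, hDF⟩ := h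
  obtain ⟨f, rfl⟩ := G.exists_lap_of_divisorEquiv hDF
  rw [← G.divisorDegree_sub_lap D f]
  exact Finset.sum_nonneg fun v _ => hF v

lemma exists_effective_of_divisorRank_pos {D : V → ℤ} (h : 0 < G.divisorRank D) (v : V) :
    ∃ f, 0 ≤ D - G.lap f ∧ 0 < (D - G.lap f) v := by
  classical
  unfold divisorRank at h
  split_ifs at h with hw
  swap
  · norm_num at h
  set R := {r : ℕ | ∀ E : V → ℤ, 0 ≤ E → divisorDegree E = r → G.IsWinnable (D - E)} with hR
  have hpos : 0 < sSup R := by exact_mod_cast h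
  obtain ⟨r, hr, hr0⟩ : ∃ r ∈ R, 0 < r := by
    by_contra! hcon
    have : sSup R ≤ 0 := by
      rcases R.eq_empty_or_nonempty with h0 | h0
      · simp [h0]
      · exact csSup_le h0 hcon
    omega
  -- Placing all of the degree of `E` at `v` avoids showing that the set of admissible `r` is
  -- downward closed.
  obtain ⟨F, hF, hDF⟩ := hr (Pi.single v (r : ℤ)) (by simp) (by simp [divisorDegree])
  obtain ⟨f, rfl⟩ := G.exists_lap_of_divisorEquiv hDF
  have hle : ∀ w, (Pi.single v (r : ℤ) : V → ℤ) w ≤ (D - G.lap f) w := fun w => by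
    have := hF w
    simp only [Pi.zero_apply, Pi.sub_apply] at this ⊢
    linarith
  refine ⟨f, fun w => le_trans ?_ (hle w), lt_of_lt_of_le ?_ (hle v)⟩
  · by_cases hwv : w = v
    · subst hwv; simp
    · simp [hwv]
  · simpa using hr0

lemma divisorRank_pos [Nonempty V] {D : V → ℤ} (hD : 0 ≤ D)
    (h : ∀ v, G.IsWinnable (D - Pi.single v 1)) : 0 < G.divisorRank D := by
  classical
  unfold divisorRank
  rw [if_pos ⟨D, hD, Relation.ReflTransGen.refl⟩]
  set R := {r : ℕ | ∀ E : V → ℤ, 0 ≤ E → divisorDegree E = r → G.IsWinnable (D - E)} with hR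
  -- Needed because the supremum of an unbounded set of naturals is 0 by convention.
  have hbdd : BddAbove R := by
    refine ⟨(divisorDegree D).toNat, fun r hr => ?_⟩
    obtain ⟨v⟩ := ‹Nonempty V›
    have := (hr (Pi.single v (r : ℤ)) (by simp) (by simp [divisorDegree])).divisorDegree_nonneg
    simp [divisorDegree, Finset.sum_sub_distrib] at this
    simp only [divisorDegree]
    omega
  have h1 : 1 ∈ R := by
    intro E hE hdeg
    obtain ⟨v, hv⟩ : ∃ v, 0 < E v := by
      by_contra! hcon
      have : divisorDegree E ≤ 0 := Finset.sum_nonpos fun v _ => hcon v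
      simp [hdeg] at this
    have hsum : ∑ w, (E - Pi.single v 1 : V → ℤ) w = 0 := by
      have : ∑ w, E w = 1 := by simpa [divisorDegree] using hdeg
      simp [Finset.sum_sub_distrib, this]
    have hnn : ∀ w ∈ Finset.univ, 0 ≤ (E - Pi.single v 1 : V → ℤ) w := fun w _ => by
      by_cases hwv : w = v
      · subst hwv; simp only [Pi.sub_apply, Pi.single_eq_same]; omega
      · simpa [hwv] using hE w
    have : E = Pi.single v 1 := by
      funext w
      have := (Finset.sum_eq_zero_iff_of_nonneg hnn).1 hsum w (Finset.mem_univ _)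
      simp only [Pi.sub_apply] at this
      omega
    rw [this]
    exact h v
  have := le_csSup hbdd h1
  omega

/-- The complement of an independent set, as a divisor, has positive rank. -/
lemma divisorRank_pos_of_isIndepSet [Nonempty V] (I : Finset V) (hI : G.IsIndepSet (I : Set V))
    (hadj : ∀ v ∈ I, ∃ w, G.Adj v w) :
    0 < G.divisorRank (fun v => if v ∈ Iᶜ then 1 else 0) := by
  refine G.divisorRank_pos (fun v => by dsimp only; split_ifs <;> simp) fun v => ?_
  by_cases hv : v ∈ I
  -- Firing all vertices but `v` costs one chip at each neighbour of `v`; by independence these lie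
  -- outside `I` and have one.
  · refine ⟨_, fun w => ?_, G.divisorEquiv_sub_lap_indicator _ {v}ᶜ⟩
    by_cases hwv : w = v
    · subst hwv
      obtain ⟨u, hu⟩ := hadj w hv
      have := G.lap_indicator_lt ({w}ᶜ : Finset V) (v := w) (by simp)
        (Finset.mem_compl.2 (Finset.notMem_singleton.2 hu.ne')) hu
      simp only [Pi.zero_apply, Pi.sub_apply, Pi.single_eq_same, Finset.mem_compl, hv,
        not_true, if_false] at this ⊢
      linarith
    · rw [Pi.zero_apply, Pi.sub_apply, G.lap_indicator_eq ({v}ᶜ : Finset V) (by simpa using hwv),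
        compl_compl, Finset.filter_singleton]
      by_cases hw : w ∈ I
      · simp [hw, hwv, hI hw hv hwv]
      · simp only [Pi.sub_apply, Finset.mem_compl, hw, Pi.single_eq_of_ne hwv, not_false_eq_true,
          if_true]
        split_ifs <;> simp
  · refine ⟨_, fun w => ?_, Relation.ReflTransGen.refl⟩
    by_cases hwv : w = v
    · subst hwv; simp [hv]
    · simp only [Pi.zero_apply, Pi.sub_apply, Pi.single_eq_of_ne hwv]
      split_ifs <;> simp

end Laplacian

/-! ### The order of a scramble bounds gonality from below. -/

section ScrambleBound

variable {V : Type*} {G : SimpleGraph V}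

/-- A connected vertex set that meets `U` without edges leaving `U` lies in `U`. -/
lemma subset_of_connected_of_closed {E U : Finset V} (hE : (G.induce (E : Set V)).Connected)
    {w : V} (hwE : w ∈ E) (hwU : w ∈ U)
    (h : ∀ x ∈ E, ∀ y ∈ E, G.Adj x y → x ∈ U → y ∈ U) : E ⊆ U := by
  intro y hy
  have hr := (reachable_iff_reflTransGen _ _).1 (hE.preconnected ⟨w, hwE⟩ ⟨y, hy⟩)
  have key : ∀ z : (E : Set V), Relation.ReflTransGen (G.induce (E : Set V)).Adj ⟨w, hwE⟩ z →
      (z : V) ∈ U := by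
    intro z hz
    induction hz with
    | refl => exact hwU
    | @tail b c _ hbc ih => exact h b b.2 c c.2 hbc ih
  exact key _ hr

variable [Fintype V] [DecidableEq V] [DecidableRel G.Adj]

omit [Fintype V] [DecidableEq V] in
lemma card_interedges_eq_sum (A B : Finset V) :
    (G.interedges A B).card = ∑ a ∈ A, (B.filter (G.Adj a)).card := by
  simp only [interedges, Rel.interedges, Finset.card_filter, Finset.sum_product]

/-- A legal set-firing from an effective divisor crosses at most as many edges as the degree. -/
lemma card_interedges_le_degree {D : V → ℤ} (hD : 0 ≤ D) (U : Finset V)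
    (h : 0 ≤ D - G.lap (fun w => if w ∈ U then 1 else 0)) :
    ((G.interedges U Uᶜ).card : ℤ) ≤ divisorDegree D := by
  rw [card_interedges_eq_sum]
  push_cast
  calc ∑ a ∈ U, ((Uᶜ.filter (G.Adj a)).card : ℤ) ≤ ∑ a ∈ U, D a := by
        refine Finset.sum_le_sum fun a ha => ?_
        have := h a
        rw [Pi.sub_apply, G.lap_indicator_eq U ha] at this
        simpa using this
    _ ≤ divisorDegree D := Finset.sum_le_sum_of_subset_of_nonneg (Finset.subset_univ _)
        fun v _ _ => hD v

namespace Scramble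

variable (S : G.Scramble)

open Classical in
/-- The eggs on which the divisor `D` has a chip. -/
noncomputable def hitEggs (D : V → ℤ) : Finset (Finset V) :=
  Finset.univ.filter fun E => E ∈ S.eggs ∧ ∃ v ∈ E, 0 < D v

omit [DecidableEq V] [DecidableRel G.Adj] in
lemma mem_hitEggs {D : V → ℤ} {E : Finset V} :
    E ∈ S.hitEggs D ↔ E ∈ S.eggs ∧ ∃ v ∈ E, 0 < D v := by
  simp [hitEggs]

/-- If `D` hits the maximum number of eggs in its class and misses the egg `E`, which some
equivalent effective divisor hits, then a legal set-firing yields an egg-cut. -/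
lemma exists_isEggCut {d : ℤ} {E : Finset V} (hE : E ∈ S.eggs) (n : ℕ) :
    ∀ (D f : V → ℤ), 0 ≤ D → divisorDegree D = d →
      (∀ g, 0 ≤ D - G.lap g → (S.hitEggs (D - G.lap g)).card ≤ (S.hitEggs D).card) →
      E ∉ S.hitEggs D → 0 ≤ D - G.lap f → E ∈ S.hitEggs (D - G.lap f) →
      (∀ v, 0 ≤ f v ∧ f v ≤ n) → ∃ A, S.IsEggCut A ∧ ((G.interedges A Aᶜ).card : ℤ) ≤ d := by
  induction n with
  | zero =>
    intro D f _ _ _ hED _ hEF hf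
    have : f = 0 := funext fun v => by have := hf v; simp only [Pi.zero_apply]; omega
    rw [this, lap_zero, sub_zero] at hEF
    exact absurd hEF hED
  | succ n ih =>
    intro D f hD hd hmax hED hF hEF hf
    -- The top level set of `f`. If it is empty, nothing is fired and the bound on `f` still drops.
    set U : Finset V := Finset.univ.filter fun v => f v = n + 1 with hU
    have hmem : ∀ v, v ∈ U ↔ f v = n + 1 := by simp [hU]
    set u : V → ℤ := fun w => if w ∈ U then 1 else 0 with hu
    -- Along each edge leaving `U`, `f` drops by at least 1, so firing `U` costs no more than firing
    -- `f`. Hence firing `U` is legal.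
    have hle : ∀ v ∈ U, G.lap u v ≤ G.lap f v := by
      intro v hv
      refine Finset.sum_le_sum fun w _ => ?_
      have h1 := (hmem v).1 hv
      have h2 := (hf w).2
      have h3 := hmem w
      simp only [hu, hv, if_true]
      by_cases hw : w ∈ U
      · simp only [hw, if_true]; push_cast at h2; split_ifs <;> linarith
      · have : f w ≠ n + 1 := fun h => hw (h3.2 h)
        simp only [hw, if_false]; push_cast at h2; split_ifs <;> omega
    have hnn : ∀ v ∈ U, 0 ≤ G.lap u v := by
      intro v hv
      rw [G.lap_indicator_eq U hv]
      positivity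
    have hgain : ∀ v ∉ U, D v ≤ (D - G.lap u) v := fun v hv => by
      have := G.lap_indicator_nonpos U hv
      simp only [Pi.sub_apply]
      linarith
    have hD1 : 0 ≤ D - G.lap u := by
      intro v
      by_cases hv : v ∈ U
      · have h1 := hF v
        have h2 := hle v hv
        simp only [Pi.sub_apply, Pi.zero_apply] at h1 ⊢
        linarith
      · exact (hD v).trans (hgain v hv)
    by_cases hsub : S.hitEggs D ⊆ S.hitEggs (D - G.lap u)
    · have heq := Finset.eq_of_subset_of_card_le hsub (hmax u hD1)
      have hsplit : D - G.lap f = D - G.lap u - G.lap (f - u) := by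
        rw [lap_sub]; abel
      refine ih (D - G.lap u) (f - u) hD1 (by rw [divisorDegree_sub_lap, hd]) ?_ (heq ▸ hED)
        (hsplit ▸ hF) (hsplit ▸ hEF) ?_
      · intro g hg
        rw [← heq]
        have : D - G.lap u - G.lap g = D - G.lap (u + g) := by rw [lap_add]; abel
        rw [this] at hg ⊢
        exact hmax _ hg
      · intro v
        have h1 := hf v
        have h2 := hmem v
        simp only [Pi.sub_apply, hu]
        push_cast at h1
        by_cases hv : v ∈ U
        · have := h2.1 hv
          simp only [hv, if_true]; omega
        · have : f v ≠ n + 1 := fun h => hv (h2.2 h)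
          simp only [hv, if_false]; omega
    -- The lost egg `E'` lies in `U`, since a vertex outside `U` never loses chips and gains one
    -- across any edge from `U`. The egg `E` lies in `Uᶜ`: it has no chips to send across the cut,
    -- and the vertex where it is finally hit must have gained.
    · obtain ⟨E', hE'D, hE'⟩ := Finset.not_subset.1 hsub
      obtain ⟨hE'S, w, hwE', hw⟩ := S.mem_hitEggs.1 hE'D
      have hE'0 : ∀ v ∈ E', (D - G.lap u) v ≤ 0 := by
        intro v hv
        by_contra! h
        exact hE' (S.mem_hitEggs.2 ⟨hE'S, v, hv, h⟩)
      have hE0 : ∀ v ∈ E, D v ≤ 0 := by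
        intro v hv
        by_contra! h
        exact hED (S.mem_hitEggs.2 ⟨hE, v, hv, h⟩)
      refine ⟨U, ⟨⟨E', hE'S, ?_⟩, E, hE, ?_⟩, hd ▸ card_interedges_le_degree hD U hD1⟩
      · refine subset_of_connected_of_closed (S.connected E' hE'S) hwE' ?_ ?_
        · by_contra h
          have := hgain w h
          have := hE'0 w hwE'
          omega
        · intro x _ y hy hxy hx
          by_contra h
          have h1 := G.lap_indicator_lt U h hx hxy.symm
          have h2 := hE'0 y hy
          have h3 := hD y
          simp only [Pi.sub_apply, Pi.zero_apply] at h2 h3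
          linarith
      · obtain ⟨-, v, hv, hvF⟩ := S.mem_hitEggs.1 hEF
        refine subset_of_connected_of_closed (S.connected E hE) hv ?_ ?_
        · rw [Finset.mem_compl]
          intro h
          have h1 := hle v h
          have h2 := hnn v h
          have h3 := hE0 v hv
          simp only [Pi.sub_apply] at hvF
          linarith
        · intro x _ y hy hxy hx
          rw [Finset.mem_compl] at hx ⊢
          intro hyU
          have h1 := G.lap_indicator_eq U hyU
          have h2 : 0 < (Uᶜ.filter (G.Adj y)).card :=
            Finset.card_pos.2 ⟨x, by simp [hx, hxy.symm]⟩
          have h3 := hE0 y hy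
          have h4 := hD1 y
          simp only [Pi.sub_apply, Pi.zero_apply] at h4
          have h5 : (0 : ℤ) < (Uᶜ.filter (G.Adj y)).card := by exact_mod_cast h2
          linarith

/-- The order of a scramble is at most the degree of any divisor of positive rank. -/
theorem order_le_divisorDegree [Nonempty V] {D : V → ℤ} (hD : 0 < G.divisorRank D) :
    S.order ≤ ((divisorDegree D).toNat : ℕ∞) := by
  classical
  obtain ⟨v₀⟩ := ‹Nonempty V›
  obtain ⟨f₀, hf₀, -⟩ := G.exists_effective_of_divisorRank_pos hD v₀
  set C : Set (V → ℤ) := {f | 0 ≤ D - G.lap f} with hC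
  obtain ⟨f₁, hf₁, hmax⟩ : ∃ f ∈ C, ∀ g ∈ C,
      (S.hitEggs (D - G.lap g)).card ≤ (S.hitEggs (D - G.lap f)).card := by
    -- `C` may be infinite, but the number of eggs hit is bounded.
    have hfin : ((fun f => (S.hitEggs (D - G.lap f)).card) '' C).Finite := by
      refine (Set.finite_Iic (Fintype.card (Finset V))).subset ?_
      rintro _ ⟨f, -, rfl⟩
      exact Finset.card_le_univ _
    obtain ⟨_, ⟨f, hf, rfl⟩, hm⟩ := hfin.exists_maximalFor id _ ⟨_, f₀, hf₀, rfl⟩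
    refine ⟨f, hf, fun g hg => ?_⟩
    by_contra! hlt
    exact absurd (hm ⟨g, hg, rfl⟩ hlt.le) (not_le.2 hlt)
  set D₁ := D - G.lap f₁ with hD₁
  have hdeg : divisorDegree D₁ = divisorDegree D := G.divisorDegree_sub_lap D f₁
  by_cases hall : ∀ E ∈ S.eggs, E ∈ S.hitEggs D₁
  · refine (min_le_left _ _).trans ?_
    set H : Finset V := Finset.univ.filter fun v => 0 < D₁ v with hH
    refine (iInf₂_le H ?_).trans ?_
    · intro E hE
      obtain ⟨-, v, hv, h⟩ := S.mem_hitEggs.1 (hall E hE)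
      exact ⟨v, by simp [hH, hv, h]⟩
    · have : (H.card : ℤ) ≤ divisorDegree D₁ := by
        calc (H.card : ℤ) = ∑ v ∈ H, (1 : ℤ) := by simp
          _ ≤ ∑ v ∈ H, D₁ v := Finset.sum_le_sum fun v hv => by
              have : 0 < D₁ v := by simpa [hH] using hv
              omega
          _ ≤ divisorDegree D₁ := Finset.sum_le_sum_of_subset_of_nonneg (Finset.subset_univ _)
              fun v _ _ => hf₁ v
      exact_mod_cast (show H.card ≤ (divisorDegree D).toNat by omega)
  · push Not at hall
    obtain ⟨E, hE, hED⟩ := hall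
    obtain ⟨⟨v, hv⟩⟩ := (S.connected E hE).nonempty
    obtain ⟨f, hf, hfv⟩ := G.exists_effective_of_divisorRank_pos hD v
    -- Subtracting the minimum does not change the Laplacian and makes the firing function
    -- nonnegative.
    obtain ⟨w, -, hw⟩ := Finset.exists_min_image Finset.univ (f - f₁) ⟨v₀, Finset.mem_univ _⟩
    set g : V → ℤ := fun x => (f - f₁) x - (f - f₁) w with hg
    obtain ⟨x, -, hx⟩ := Finset.exists_max_image Finset.univ g ⟨v₀, Finset.mem_univ _⟩
    have hgD : D₁ - G.lap g = D - G.lap f := by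
      rw [hg, lap_sub_const, lap_sub, hD₁]; abel
    have hgnn : ∀ y, 0 ≤ g y := fun y => by
      have := hw y (Finset.mem_univ _)
      simp only [hg]; omega
    obtain ⟨A, hA, hcard⟩ := S.exists_isEggCut (d := divisorDegree D) hE (g x).toNat D₁ g hf₁ hdeg
      (fun k hk => by
        have : D₁ - G.lap k = D - G.lap (f₁ + k) := by rw [lap_add, hD₁]; abel
        rw [this] at hk ⊢
        exact hmax _ hk) hED (hgD ▸ hf) (hgD ▸ S.mem_hitEggs.2 ⟨hE, v, hv, hfv⟩)
      (fun y => ⟨hgnn y, by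
        have := hx y (Finset.mem_univ _)
        have := hgnn x
        omega⟩)
    refine (min_le_right _ _).trans ((iInf₂_le A hA).trans ?_)
    exact_mod_cast (show (G.interedges A Aᶜ).card ≤ (divisorDegree D).toNat by omega)

end Scramble

/-- The scramble number does not decrease when edges are added on the same vertex set. -/
lemma scrambleNumber_mono {H : SimpleGraph V} [DecidableRel H.Adj] (h : G ≤ H) :
    G.scrambleNumber ≤ H.scrambleNumber := by
  refine iSup_le fun S => ?_
  let T : H.Scramble := ⟨S.eggs, fun E hE => (S.connected E hE).mono fun a b hab => h hab⟩
  refine le_trans (min_le_min le_rfl ?_) (le_iSup (fun S : H.Scramble => S.order) T)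
  refine le_iInf₂ fun A hA => (iInf₂_le A hA).trans ?_
  have : (G.interedges A Aᶜ).card ≤ (H.interedges A Aᶜ).card := by
    refine Finset.card_le_card fun p hp => ?_
    rw [mem_interedges_iff] at hp ⊢
    exact ⟨hp.1, hp.2.1, h hp.2.2⟩
  exact_mod_cast this

lemma scrambleNumber_le_divisorDegree [Nonempty V] {D : V → ℤ} (hD : 0 < G.divisorRank D) :
    G.scrambleNumber ≤ ((divisorDegree D).toNat : ℕ∞) :=
  iSup_le fun S => S.order_le_divisorDegree hD

/-- A scramble of order at least `n` and a divisor of positive rank and degree `n` determine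
both the scramble number and the gonality. -/
lemma scrambleNumber_eq_and_gonality_eq [Nonempty V] {n : ℕ} {D : V → ℤ}
    (hn : (n : ℕ∞) ≤ G.scrambleNumber) (hD : 0 < G.divisorRank D) (hdeg : divisorDegree D = n) :
    G.scrambleNumber = n ∧ G.gonality = n := by
  refine ⟨le_antisymm ?_ hn, IsLeast.csInf_eq ⟨⟨D, hD, hdeg⟩, ?_⟩⟩
  · simpa [hdeg] using scrambleNumber_le_divisorDegree hD
  · rintro _ ⟨D', hD', rfl⟩
    have h : n ≤ (divisorDegree D').toNat := by
      exact_mod_cast hn.trans (scrambleNumber_le_divisorDegree hD')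
    -- For `n = 0` the bound through `toNat` does not exclude negative degrees.
    rcases Nat.eq_zero_or_pos n with h0 | h0
    · obtain ⟨f, hf, -⟩ := G.exists_effective_of_divisorRank_pos hD' (Classical.arbitrary V)
      rw [h0, Nat.cast_zero, ← G.divisorDegree_sub_lap D' f]
      exact Finset.sum_nonneg fun v _ => hf v
    · omega

end ScrambleBound

/-! ### Edge isoperimetry in the cube: the egg-cut bound. -/

section Isoperimetry

/-- The number of hypercube edges leaving `A`. -/
def cubeBoundary {n : ℕ} (A : Finset (Fin n → Bool)) : ℕ :=
  ∑ x ∈ A, ∑ i, if Function.update x i (!x i) ∈ A then 0 else 1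

/-- The slice of `A` with first coordinate `b`. -/
def cubeSlice {n : ℕ} (A : Finset (Fin (n + 1) → Bool)) (b : Bool) : Finset (Fin n → Bool) :=
  Finset.univ.filter fun x => (Fin.cons b x : Fin (n + 1) → Bool) ∈ A

lemma mem_cubeSlice {n : ℕ} {A : Finset (Fin (n + 1) → Bool)} {b : Bool} {x : Fin n → Bool} :
    x ∈ cubeSlice A b ↔ (Fin.cons b x : Fin (n + 1) → Bool) ∈ A := by
  simp [cubeSlice]

lemma sum_eq_sum_cubeSlice {n : ℕ} (A : Finset (Fin (n + 1) → Bool))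
    (F : (Fin (n + 1) → Bool) → ℕ) :
    ∑ x ∈ A, F x
      = ∑ x ∈ cubeSlice A true, F (Fin.cons true x) +
        ∑ x ∈ cubeSlice A false, F (Fin.cons false x) := by
  simp only [cubeSlice, Finset.sum_filter]
  rw [← Fintype.sum_ite_mem A F, ← (Fin.consEquiv fun _ => Bool).sum_comp,
    Fintype.sum_prod_type, Fintype.sum_bool]
  rfl

lemma card_eq_card_cubeSlice {n : ℕ} (A : Finset (Fin (n + 1) → Bool)) :
    A.card = (cubeSlice A true).card + (cubeSlice A false).card := by
  simpa using sum_eq_sum_cubeSlice A fun _ => 1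

lemma sum_cubeSlice_boundary {n : ℕ} (A : Finset (Fin (n + 1) → Bool)) (b : Bool) :
    (∑ x ∈ cubeSlice A b, ∑ i, if Function.update (Fin.cons b x : Fin (n + 1) → Bool) i
        (!(Fin.cons b x : Fin (n + 1) → Bool) i) ∈ A then 0 else 1)
      = (cubeSlice A b \ cubeSlice A (!b)).card + cubeBoundary (cubeSlice A b) := by
  simp only [Fin.sum_univ_succ, Finset.sum_add_distrib, Fin.update_cons_zero, Fin.cons_zero,
    Fin.cons_succ, ← Fin.cons_update, cubeBoundary, mem_cubeSlice]
  congr 1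
  rw [← Finset.filter_notMem_eq_sdiff, Finset.card_filter]
  refine Finset.sum_congr rfl fun x _ => ?_
  simp only [mem_cubeSlice]
  split_ifs <;> rfl

/-- Boundary edges in the first direction lie exactly over the symmetric difference of the two
slices. -/
lemma cubeBoundary_succ {n : ℕ} (A : Finset (Fin (n + 1) → Bool)) :
    cubeBoundary A = cubeBoundary (cubeSlice A true) + cubeBoundary (cubeSlice A false) +
      (cubeSlice A true \ cubeSlice A false).card +
      (cubeSlice A false \ cubeSlice A true).card := by
  rw [cubeBoundary, sum_eq_sum_cubeSlice, sum_cubeSlice_boundary, sum_cubeSlice_boundary]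
  simp only [Bool.not_true, Bool.not_false]
  ring

/-- Lower bounds for the edge boundary pass from dimension `n` to dimension `n + 1`. -/
lemma le_cubeBoundary_succ {n : ℕ} {t u : List ℕ}
    (ht : ∀ A : Finset (Fin n → Bool), t.getD A.card 0 ≤ cubeBoundary A)
    (hu : ∀ a ∈ List.range (2 ^ n + 1), ∀ b ∈ List.range (2 ^ n + 1),
      u.getD (a + b) 0 ≤ t.getD a 0 + t.getD b 0 + ((a - b) + (b - a)))
    (A : Finset (Fin (n + 1) → Bool)) : u.getD A.card 0 ≤ cubeBoundary A := by
  have hcard : ∀ B : Finset (Fin n → Bool), B.card ∈ List.range (2 ^ n + 1) := fun B => by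
    have := Finset.card_le_univ B
    simp at this
    simp only [List.mem_range]
    omega
  have h := hu _ (hcard (cubeSlice A true)) _ (hcard (cubeSlice A false))
  have h1 := ht (cubeSlice A true)
  have h2 := ht (cubeSlice A false)
  have h3 := Finset.le_card_sdiff (cubeSlice A false) (cubeSlice A true)
  have h4 := Finset.le_card_sdiff (cubeSlice A true) (cubeSlice A false)
  rw [card_eq_card_cubeSlice, cubeBoundary_succ]
  omega

/-- A set of at least `6` and at most `26` vertices of the `5`-cube has edge boundary at least
`16`. -/
lemma sixteen_le_cubeBoundary (A : Finset (Fin 5 → Bool)) (h6 : 6 ≤ A.card)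
    (h26 : A.card ≤ 26) : 16 ≤ cubeBoundary A := by
  have b0 : ∀ A : Finset (Fin 0 → Bool), [0].getD A.card 0 ≤ cubeBoundary A := fun A => by
    rcases A.card with _ | _ <;> simp
  -- Entry `k` of each table is a lower bound for the boundary of sets of size `k`, checked against
  -- all splittings of `k` into two slices.
  have b1 := le_cubeBoundary_succ (u := [0, 1, 0]) b0 (by decide)
  have b2 := le_cubeBoundary_succ (u := [0, 2, 2, 2, 0]) b1 (by decide)
  have b3 := le_cubeBoundary_succ (u := [0, 3, 4, 5, 4, 5, 4, 3, 0]) b2 (by decide)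
  have b4 := le_cubeBoundary_succ
    (u := [0, 4, 6, 8, 8, 10, 10, 10, 8, 10, 10, 10, 8, 8, 6, 4, 0]) b3 (by decide +kernel)
  -- Entries 6 to 26 are 16; elsewhere only the trivial bound 0 is claimed.
  have b5 := le_cubeBoundary_succ
    (u := List.replicate 6 0 ++ List.replicate 21 16) b4 (by decide +kernel) A
  generalize A.card = k at h6 h26 b5
  interval_cases k <;> simpa using b5

lemma hypercube_adj_update {n : ℕ} (x : Fin n → Bool) (i : Fin n) :
    (hypercube n).Adj x (Function.update x i (!x i)) := by
  change hammingDist _ _ = 1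
  rw [hammingDist, Finset.card_eq_one]
  refine ⟨i, Finset.ext fun j => ?_⟩
  by_cases h : j = i
  · subst h; simp
  · simp [h]

lemma cubeBoundary_le_card_interedges {n : ℕ} (A : Finset (Fin n → Bool)) :
    cubeBoundary A ≤ ((hypercube n).interedges A Aᶜ).card := by
  rw [card_interedges_eq_sum]
  refine Finset.sum_le_sum fun x _ => ?_
  have : (∑ i, if Function.update x i (!x i) ∈ A then 0 else 1)
      = (Finset.univ.filter fun i => Function.update x i (!x i) ∉ A).card := by
    rw [Finset.card_filter]
    refine Finset.sum_congr rfl fun i _ => ?_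
    split_ifs <;> rfl
  rw [this]
  refine Finset.card_le_card_of_injOn (fun i => Function.update x i (!x i)) ?_ ?_
  · intro i hi
    simpa [hypercube_adj_update] using hi
  · intro i _ j _ hij
    by_contra hne
    have := congrFun hij i
    simp [hne] at this

lemma sixteen_le_eggCutNumber_hypercube :
    16 ≤ ((hypercube 5).uniformScramble 6).eggCutNumber := by
  refine le_iInf₂ fun A hA => ?_
  obtain ⟨⟨E, ⟨hE, -⟩, hEA⟩, E', ⟨hE', -⟩, hEA'⟩ := hA
  have h1 := Finset.card_le_card hEA
  have h2 := Finset.card_le_card hEA'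
  have h3 := Finset.card_add_card_compl A
  simp only [Fintype.card_pi, Fintype.card_bool, Finset.prod_const, Finset.card_univ,
    Fintype.card_fin] at h3
  have := (sixteen_le_cubeBoundary A (by omega) (by omega)).trans
    (cubeBoundary_le_card_interedges A)
  exact_mod_cast this

end Isoperimetry

namespace CubeSearch

/-! ### Connected six-sets in large subsets of the `5`-cube

Vertices of the `5`-cube are encoded by the natural numbers below `32`, neighbours differing in one
binary digit. -/

/-- Two codes differ in exactly one of the five lowest binary digits. -/
def codeAdj (a b : ℕ) : Bool :=
  let d := a ^^^ b
  d == 1 || d == 2 || d == 4 || d == 8 || d == 16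

lemma codeAdj_xor (a b t : ℕ) : codeAdj (a ^^^ t) (b ^^^ t) = codeAdj a b := by
  have : a ^^^ t ^^^ (b ^^^ t) = a ^^^ b := by
    rw [Nat.xor_comm b t, ← Nat.xor_assoc, Nat.xor_xor_cancel_right]
  simp only [codeAdj, this]

/-- A list of distinct codes satisfying `p`, each adjacent to a later one (except the last). -/
inductive IsClump (p : ℕ → Bool) : List ℕ → Prop
  | single (n : ℕ) (hn : p n = true) : IsClump p [n]
  | cons (n m : ℕ) (l : List ℕ) (hn : p n = true) (hnl : n ∉ l) (hm : m ∈ l)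
      (h : codeAdj n m = true) (hl : IsClump p l) : IsClump p (n :: l)

/-- `p` holds on no connected set of six codes. -/
def NoClump (p : ℕ → Bool) : Prop := ∀ l, IsClump p l → l.length < 6

/-- Translation by `t` is an automorphism; it serves to move a chosen code to 0. -/
lemma IsClump.map_xor {p : ℕ → Bool} {t : ℕ} {l : List ℕ}
    (h : IsClump (fun n => p (n ^^^ t)) l) : IsClump p (l.map (· ^^^ t)) := by
  induction h with
  | single n hn => exact .single _ hn
  | cons n m l hn hnl hm hnm _ ih =>
    refine .cons _ (m ^^^ t) _ hn ?_ (List.mem_map_of_mem hm) (by rwa [codeAdj_xor]) ih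
    rw [List.mem_map]
    rintro ⟨k, hk, hkn⟩
    exact hnl (Nat.xor_left_injective hkn ▸ hk)

lemma NoClump.xor {p : ℕ → Bool} (h : NoClump p) (t : ℕ) : NoClump fun n => p (n ^^^ t) :=
  fun l hl => by simpa using h _ hl.map_xor

/-- Does the connected list `l` grow inside `rest` to at least six elements? -/
def grows : ℕ → List ℕ → List ℕ → Bool
  | 0, _, _ => false
  | k + 1, l, rest =>
    let new := rest.filter fun x => l.any (codeAdj x)
    decide (6 ≤ new.length + l.length) ||
      grows k (new ++ l) (rest.filter fun x => !l.any (codeAdj x))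

lemma IsClump.append {p : ℕ → Bool} {l : List ℕ} (hl : IsClump p l) (new : List ℕ)
    (hnew : ∀ x ∈ new, p x = true ∧ l.any (codeAdj x) = true) (hd : (new ++ l).Nodup) :
    IsClump p (new ++ l) := by
  induction new with
  | nil => exact hl
  | cons x new ih =>
    rw [List.cons_append, List.nodup_cons] at hd
    obtain ⟨hx, hxl⟩ := hnew x List.mem_cons_self
    obtain ⟨m, hm, hxm⟩ := List.any_eq_true.1 hxl
    exact .cons x m _ hx hd.1 (List.mem_append_right _ hm) hxm
      (ih (fun y hy => hnew y (List.mem_cons_of_mem _ hy)) hd.2)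

/-- Each layer of new neighbours extends a clump to a clump, so six codes are never reached,
whatever the fuel. -/
lemma NoClump.grows_eq_false {p : ℕ → Bool} (hp : NoClump p) (k : ℕ) :
    ∀ l rest, IsClump p l → (rest ++ l).Nodup → (∀ x ∈ rest, p x = true) →
      grows k l rest = false := by
  induction k with
  | zero => intros; rfl
  | succ k ih =>
    intro l rest hl hd hrest
    set new := rest.filter fun x => l.any (codeAdj x) with hnew
    have hdis := List.nodup_append.1 hd
    have hclump : IsClump p (new ++ l) := by
      refine hl.append new (fun x hx => ?_) ?_
      · have := List.mem_filter.1 hx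
        exact ⟨hrest x this.1, this.2⟩
      · exact hd.sublist (List.filter_sublist.append_right l)
    have hlt := hp _ hclump
    rw [List.length_append] at hlt
    simp only [grows, ← hnew, Bool.or_eq_false_iff, decide_eq_false_iff_not, not_le]
    refine ⟨hlt, ih _ _ hclump ?_ fun x hx => hrest x (List.mem_filter.1 hx).1⟩
    rw [← List.append_assoc]
    refine (List.Perm.nodup_iff (List.Perm.append_right l ?_)).1 hd
    refine (List.filter_append_perm (fun x => l.any (codeAdj x)) rest).symm.trans ?_
    exact List.perm_append_comm

/-- Depth-first search through all sets of codes, deciding `i, i + 1, …` in turn: `ins` and `outs`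
are the codes decided so far. A branch is closed when `bad outs` holds or the newest code completes
a connected six-set; the result is `true` when all branches close within `k` levels. -/
def search (bad : List ℕ → Bool) : ℕ → ℕ → List ℕ → List ℕ → Bool
  | 0, _, _, _ => false
  | k + 1, i, ins, outs =>
    bad outs || (search bad k (i + 1) ins (i :: outs) &&
      (grows 5 [i] ins || search bad k (i + 1) (i :: ins) outs))

/-- The codes below `i` satisfying `p`, in decreasing order. -/
def codesBelow (p : ℕ → Bool) (i : ℕ) : List ℕ := ((List.range i).filter p).reverse

lemma codesBelow_succ (p : ℕ → Bool) (i : ℕ) :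
    codesBelow p (i + 1) = if p i then i :: codesBelow p i else codesBelow p i := by
  simp only [codesBelow, List.range_succ, List.filter_append, List.reverse_append]
  by_cases h : p i <;> simp [h]

lemma mem_codesBelow {p : ℕ → Bool} {i n : ℕ} : n ∈ codesBelow p i ↔ n < i ∧ p n = true := by
  simp [codesBelow]

lemma nodup_codesBelow (p : ℕ → Bool) (i : ℕ) : (codesBelow p i).Nodup :=
  List.nodup_reverse.2 (List.nodup_range.filter _)

/-- The true membership pattern of `p` traces one branch of the search, which neither `bad` nor
`grows` ever closes. -/
lemma NoClump.search_eq_false {p : ℕ → Bool} (hp : NoClump p) {bad : List ℕ → Bool} {N : ℕ}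
    (hbad : ∀ i ≤ N, bad (codesBelow (fun n => !p n) i) = false) (k : ℕ) :
    ∀ i, i + k ≤ N + 1 →
      search bad k i (codesBelow p i) (codesBelow (fun n => !p n) i) = false := by
  induction k with
  | zero => intros; rfl
  | succ k ih =>
    intro i hi
    have hnext := ih (i + 1) (by omega)
    rw [codesBelow_succ, codesBelow_succ] at hnext
    rw [search, hbad i (by omega), Bool.false_or]
    by_cases h : p i = true
    · simp only [h, Bool.not_true, if_true, Bool.false_eq_true, if_false] at hnext
      rw [hnext, hp.grows_eq_false 5 [i] _ (.single i h), Bool.false_or, Bool.and_false]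
      · rw [List.nodup_append]
        refine ⟨nodup_codesBelow _ _, List.nodup_singleton _, ?_⟩
        intro a ha b hb
        rw [List.mem_singleton] at hb
        have := (mem_codesBelow.1 ha).1
        omega
      · exact fun x hx => (mem_codesBelow.1 hx).2
    · rw [Bool.not_eq_true] at h
      simp only [h, Bool.not_false, if_true, Bool.false_eq_true, if_false] at hnext
      rw [hnext, Bool.false_and]

/-! ### Counting missing codes by octant. -/

/-- The number of codes outside `p` in the `j`-th octant `{8 j, …, 8 j + 7}`. -/
def missing (p : ℕ → Bool) (j : ℕ) : ℕ :=
  ((Finset.range 32).filter fun n => p n = false ∧ n >>> 3 = j).card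

lemma countP_codesBelow_le_missing (p : ℕ → Bool) {i : ℕ} (hi : i ≤ 32) (j : ℕ) :
    (codesBelow (fun n => !p n) i).countP (fun n => n >>> 3 == j) ≤ missing p j := by
  rw [List.countP_eq_length_filter, ← List.toFinset_card_of_nodup ((nodup_codesBelow _ _).filter _)]
  refine Finset.card_le_card fun n hn => ?_
  rw [List.mem_toFinset, List.mem_filter, mem_codesBelow] at hn
  simp only [Finset.mem_filter, Finset.mem_range]
  simp only [Bool.not_eq_true', beq_iff_eq] at hn
  exact ⟨by omega, hn.1.2, hn.2⟩

lemma xor_lt_thirty_two {n t : ℕ} (hn : n < 32) (ht : t < 32) : n ^^^ t < 32 :=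
  Nat.xor_lt_two_pow (n := 5) hn ht

lemma missing_xor (p : ℕ → Bool) {t : ℕ} (ht : t < 32) (j : ℕ) :
    missing (fun n => p (n ^^^ t)) j = missing p (j ^^^ (t >>> 3)) := by
  refine Finset.card_nbij' (· ^^^ t) (· ^^^ t) ?_ ?_ ?_ ?_
  · intro n hn
    simp only [Finset.coe_filter, Finset.mem_range, Set.mem_ofPred_eq] at hn ⊢
    exact ⟨xor_lt_thirty_two hn.1 ht, hn.2.1, by rw [Nat.shiftRight_xor_distrib, hn.2.2]⟩
  · intro n hn
    simp only [Finset.coe_filter, Finset.mem_range, Set.mem_ofPred_eq] at hn ⊢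
    refine ⟨xor_lt_thirty_two hn.1 ht, ?_, ?_⟩
    · rw [Nat.xor_xor_cancel_right]; exact hn.2.1
    · rw [Nat.shiftRight_xor_distrib, hn.2.2, Nat.xor_xor_cancel_right]
  · intro n _; exact Nat.xor_xor_cancel_right _ _
  · intro n _; exact Nat.xor_xor_cancel_right _ _

lemma card_eq_sum_missing (p : ℕ → Bool) :
    ((Finset.range 32).filter fun n => p n = false).card
      = missing p 0 + missing p 1 + missing p 2 + missing p 3 := by
  rw [Finset.card_eq_sum_card_fiberwise (f := fun n => n >>> 3) (t := Finset.range 4)]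
  · simp only [Finset.sum_range_succ, Finset.sum_range_zero, zero_add, missing,
      Finset.filter_filter]
  · intro n hn
    simp only [Finset.coe_filter, Finset.mem_range, Set.mem_ofPred_eq, Finset.coe_range,
      Set.mem_Iio, Nat.shiftRight_eq_div_pow] at hn ⊢
    omega

/-- A 3-cube with at most two vertices removed is connected and has at least six vertices. -/
lemma NoClump.three_le_missing_zero {p : ℕ → Bool} (hp : NoClump p) : 3 ≤ missing p 0 := by
  by_contra! hlt
  -- Eight levels decide the first octant; the ninth only tests `bad`.
  have := hp.search_eq_false (N := 8)
    (bad := fun outs => decide (3 ≤ outs.countP (fun n => n >>> 3 == 0)))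
    (fun i hi => by
      have := countP_codesBelow_le_missing p (i := i) (by omega) 0
      simp only [decide_eq_false_iff_not]
      omega) 9 0 (by omega)
  revert this
  simp only [codesBelow, List.range_zero, List.filter_nil, List.reverse_nil]
  decide +kernel

lemma NoClump.three_le_missing {p : ℕ → Bool} (hp : NoClump p) {j : ℕ} (hj : j < 4) :
    3 ≤ missing p j := by
  have h := (hp.xor (8 * j)).three_le_missing_zero
  rwa [missing_xor p (by omega), Nat.zero_xor, Nat.shiftRight_eq_div_pow,
    show 8 * j / 2 ^ 3 = j by omega] at h

/-- An octant with at least five codes in `p` contains a path on three of them. -/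
lemma exists_corner {p : ℕ → Bool} (h : missing p 0 ≤ 3) :
    ∃ t < 8, p t = true ∧ p (1 ^^^ t) = true ∧ p (2 ^^^ t) = true := by
  -- One of the 4-cycles 0–3 and 4–7 keeps at least three codes, which form a path.
  have key : ∀ b0 b1 b2 b3 b4 b5 b6 b7 : Bool,
      (!b0).toNat + (!b1).toNat + (!b2).toNat + (!b3).toNat + (!b4).toNat + (!b5).toNat +
        (!b6).toNat + (!b7).toNat ≤ 3 →
      (b0 && b1 && b2) || (b1 && b0 && b3) || (b2 && b3 && b0) || (b3 && b2 && b1) ||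
        (b4 && b5 && b6) || (b5 && b4 && b7) || (b6 && b7 && b4) || (b7 && b6 && b5) := by
    decide +kernel
  have hsum : missing p 0 = (!p 0).toNat + (!p 1).toNat + (!p 2).toNat + (!p 3).toNat +
      (!p 4).toNat + (!p 5).toNat + (!p 6).toNat + (!p 7).toNat := by
    have hset : (Finset.range 32).filter (fun n => p n = false ∧ n >>> 3 = 0)
        = (Finset.range 8).filter fun n => p n = false := by
      ext n
      simp only [Finset.mem_filter, Finset.mem_range, Nat.shiftRight_eq_div_pow]
      constructor
      · rintro ⟨h1, h2, h3⟩; exact ⟨by omega, h2⟩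
      · rintro ⟨h1, h2⟩; exact ⟨by omega, h2, by omega⟩
    have hb : ∀ b : Bool, (if b = false then 1 else 0) = (!b).toNat := by decide
    rw [missing, hset, Finset.card_filter]
    simp only [Finset.sum_range_succ, Finset.sum_range_zero, zero_add, hb]
  have := key _ _ _ _ _ _ _ _ (hsum ▸ h)
  simp only [Bool.or_eq_true, Bool.and_eq_true] at this
  rcases this with ((((((h | h) | h) | h) | h) | h) | h) | h
  exacts [⟨0, by omega, h.1.1, h.1.2, h.2⟩, ⟨1, by omega, h.1.1, h.1.2, h.2⟩,
    ⟨2, by omega, h.1.1, h.1.2, h.2⟩, ⟨3, by omega, h.1.1, h.1.2, h.2⟩,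
    ⟨4, by omega, h.1.1, h.1.2, h.2⟩, ⟨5, by omega, h.1.1, h.1.2, h.2⟩,
    ⟨6, by omega, h.1.1, h.1.2, h.2⟩, ⟨7, by omega, h.1.1, h.1.2, h.2⟩]

/-- More than three codes are missing from the first octant, or at least sixteen in all, given that
at least three are missing from every octant. -/
def tooManyMissing (outs : List ℕ) : Bool :=
  let c := fun j => outs.countP (fun n => n >>> 3 == j)
  decide (4 ≤ c 0) || decide (16 ≤ max 3 (c 0) + max 3 (c 1) + max 3 (c 2) + max 3 (c 3))

lemma search_eq_true : search tooManyMissing 30 3 [2, 1, 0] [] = true := by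
  decide +kernel

/-- At least sixteen codes are missing from a set of codes without a connected six-set. -/
theorem NoClump.sixteen_le {p : ℕ → Bool} (hp : NoClump p) :
    16 ≤ ((Finset.range 32).filter fun n => p n = false).card := by
  rw [card_eq_sum_missing]
  by_contra! hlt
  obtain ⟨j, hj, hj3⟩ : ∃ j < 4, missing p j ≤ 3 := by
    by_contra! h
    have := h 0 (by omega)
    have := h 1 (by omega)
    have := h 2 (by omega)
    have := h 3 (by omega)
    omega
  have hshift : (8 * j) >>> 3 = j := by rw [Nat.shiftRight_eq_div_pow]; omega
  obtain ⟨t, ht, h0, h1, h2⟩ := exists_corner (p := fun n => p (n ^^^ (8 * j)))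
    (by rwa [missing_xor p (by omega), Nat.zero_xor, hshift])
  -- The translation by `8 * j` brings the octant with few missing codes to the front; that by `t <
  -- 8` preserves octants and moves the path to 1, 0, 2.
  set q : ℕ → Bool := fun n => p (n ^^^ t ^^^ (8 * j)) with hq
  have hqc : NoClump q := (hp.xor (8 * j)).xor t
  have ht0 : t >>> 3 = 0 := by rw [Nat.shiftRight_eq_div_pow]; omega
  have hqm : ∀ i, missing q i = missing p (i ^^^ j) := fun i => by
    rw [hq, missing_xor (fun n => p (n ^^^ (8 * j))) (by omega), ht0, Nat.xor_zero,
      missing_xor p (by omega), hshift]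
  have hq0 : missing q 0 ≤ 3 := by rwa [hqm, Nat.zero_xor]
  have hqsum : missing q 0 + missing q 1 + missing q 2 + missing q 3 < 16 := by
    simp only [hqm]
    interval_cases j <;> simp only [Nat.reduceXor] <;> omega
  -- Each `max 3 (c j)` is at most `missing q j`, so the pruning test never fires on `q`. Thirty
  -- levels run from code 3 to the last test at 32.
  have hsearch := hqc.search_eq_false (N := 32) (bad := tooManyMissing) (fun i hi => by
    have := countP_codesBelow_le_missing q hi 0
    have := countP_codesBelow_le_missing q hi 1
    have := countP_codesBelow_le_missing q hi 2
    have := countP_codesBelow_le_missing q hi 3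
    have := hqc.three_le_missing (j := 0) (by omega)
    have := hqc.three_le_missing (j := 1) (by omega)
    have := hqc.three_le_missing (j := 2) (by omega)
    have := hqc.three_le_missing (j := 3) (by omega)
    simp only [tooManyMissing, Bool.or_eq_false_iff, decide_eq_false_iff_not]
    omega) 30 3 (by omega)
  have q0 : q 0 = true := by simpa [hq] using h0
  have q1 : q 1 = true := h1
  have q2 : q 2 = true := h2
  simp [codesBelow, List.range_succ, q0, q1, q2, search_eq_true] at hsearch

/-! ### Codes as vertices of the cube -/

/-- The vertex of the `5`-cube given by the five lowest binary digits. -/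
def cubeVertex (n : ℕ) : Fin 5 → Bool := fun i => n.testBit i

lemma cubeVertex_adj : ∀ a < 32, ∀ b < 32, codeAdj a b = true →
    (hypercube 5).Adj (cubeVertex a) (cubeVertex b) := by
  decide +kernel

lemma cubeVertex_injOn : ∀ a < 32, ∀ b < 32, cubeVertex a = cubeVertex b → a = b := by
  decide +kernel

lemma IsClump.of_mem {p : ℕ → Bool} {l : List ℕ} (h : IsClump p l) : ∀ n ∈ l, p n = true := by
  induction h with
  | single n hn => simpa using hn
  | cons n m l hn _ _ _ _ ih => simpa [hn] using ih

lemma IsClump.nodup {p : ℕ → Bool} {l : List ℕ} (h : IsClump p l) : l.Nodup := by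
  induction h with
  | single n hn => simp
  | cons n m l _ hnl _ _ _ ih => exact List.nodup_cons.2 ⟨hnl, ih⟩

/-- Dropping the head of a clump leaves a clump. -/
lemma IsClump.exists_length_eq {p : ℕ → Bool} {l : List ℕ} (h : IsClump p l)
    (hl : 6 ≤ l.length) : ∃ l', IsClump p l' ∧ l'.length = 6 := by
  induction h with
  | single n hn => simp at hl
  | cons n m l hn hnl hm hnm h ih =>
    rcases hl.eq_or_lt with h6 | h6
    · exact ⟨_, .cons n m l hn hnl hm hnm h, h6.symm⟩
    · exact ih (by simpa [Nat.lt_succ_iff] using h6)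

lemma IsClump.connected {p : ℕ → Bool} (hp : ∀ n, p n = true → n < 32) {l : List ℕ}
    (h : IsClump p l) :
    ((hypercube 5).induce ((l.toFinset.image cubeVertex : Finset _) : Set _)).Connected := by
  induction h with
  | single n hn =>
    have hset : (([n].toFinset.image cubeVertex : Finset _) : Set (Fin 5 → Bool))
        = {cubeVertex n} := by simp
    rw [hset]
    exact Connected.of_subsingleton
  | cons n m l hn hnl hm hnm h ih =>
    have hadj := cubeVertex_adj n (hp n hn) m (hp m (h.of_mem m hm)) hnm
    have hmem : cubeVertex m ∈ ((l.toFinset.image cubeVertex : Finset _) : Set (Fin 5 → Bool)) :=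
      Finset.mem_coe.2 (Finset.mem_image_of_mem _ (List.mem_toFinset.2 hm))
    have := induce_union_connected (induce_pair_connected_of_adj hadj).preconnected
      ih.preconnected ⟨cubeVertex m, by simp, hmem⟩
    have hset : ((((n :: l).toFinset).image cubeVertex : Finset _) : Set (Fin 5 → Bool))
        = {cubeVertex n, cubeVertex m} ∪ ((l.toFinset.image cubeVertex : Finset _) : Set _) := by
      ext x
      rw [List.toFinset_cons, Finset.image_insert, Finset.coe_insert, Set.mem_insert_iff,
        Set.mem_union, Set.mem_insert_iff, Set.mem_singleton_iff]
      constructor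
      · tauto
      · rintro ((h | rfl) | h)
        · exact Or.inl h
        · exact Or.inr hmem
        · exact Or.inr h
    rwa [hset]

end CubeSearch

/-! ### The hitting bound and the conclusion. -/

open CubeSearch in
lemma sixteen_le_hittingNumber_hypercube :
    16 ≤ ((hypercube 5).uniformScramble 6).hittingNumber := by
  refine le_iInf₂ fun C hC => ?_
  -- The condition `n < 32` is needed because clumps range over all naturals.
  set p : ℕ → Bool := fun n => decide (n < 32 ∧ cubeVertex n ∉ C) with hp
  have hp32 : ∀ n, p n = true → n < 32 := fun n hn => (of_decide_eq_true hn).1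
  have hclump : NoClump p := by
    intro l hl
    by_contra! h6
    obtain ⟨l', hl', hlen⟩ := hl.exists_length_eq h6
    have hcard : (l'.toFinset.image cubeVertex).card = 6 := by
      rw [Finset.card_image_of_injOn, List.toFinset_card_of_nodup hl'.nodup, hlen]
      intro a ha b hb hab
      simp only [List.coe_toFinset, Set.mem_ofPred_eq] at ha hb
      exact cubeVertex_injOn a (hp32 a (hl'.of_mem a ha)) b (hp32 b (hl'.of_mem b hb)) hab
    obtain ⟨x, hx⟩ := hC _ ⟨hcard, hl'.connected hp32⟩
    rw [Finset.mem_inter, Finset.mem_image] at hx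
    obtain ⟨hxC, n, hn, rfl⟩ := hx
    exact (of_decide_eq_true (hl'.of_mem n (List.mem_toFinset.1 hn))).2 hxC
  have : 16 ≤ C.card := by
    refine hclump.sixteen_le.trans (Finset.card_le_card_of_injOn cubeVertex ?_ ?_)
    · intro n hn
      simp only [hp, Finset.coe_filter, Finset.mem_range, Set.mem_ofPred_eq,
        decide_eq_false_iff_not, not_and, not_not] at hn
      exact hn.2 hn.1
    · intro a ha b hb hab
      simp only [Finset.coe_filter, Finset.mem_range, Set.mem_ofPred_eq] at ha hb
      exact cubeVertex_injOn a ha.1 b hb.1 hab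
  exact_mod_cast this

lemma hypercube_le_foldedCube (n : ℕ) : hypercube n ≤ foldedCube n := le_sup_left

lemma sixteen_le_order_uniformScramble :
    16 ≤ ((hypercube 5).uniformScramble 6).order :=
  le_min sixteen_le_hittingNumber_hypercube sixteen_le_eggCutNumber_hypercube

/-- The vertices of the `5`-cube of odd weight. -/
def oddVertices : Finset (Fin 5 → Bool) :=
  Finset.univ.filter fun x => (∑ i, (x i).toNat) % 2 = 1

/-- Edges flip one or all five coordinates, so they change the parity of the weight. -/
lemma isIndepSet_oddVertices_foldedCube :
    (foldedCube 5).IsIndepSet (oddVertices : Set (Fin 5 → Bool)) := by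
  have h : ∀ x ∈ oddVertices, ∀ y ∈ oddVertices, ¬ (foldedCube 5).Adj x y := by decide +kernel
  exact fun x hx y hy _ => h x hx y hy

lemma divisorDegree_oddVertices_compl :
    divisorDegree (fun v => if v ∈ oddVerticesᶜ then 1 else 0) = (16 : ℕ) := by
  decide +kernel

end SimpleGraph

open SimpleGraph in
theorem mainTheorem10 :
    ((SimpleGraph.hypercube 5).uniformScramble 6).order = 16 ∧
    (SimpleGraph.hypercube 5).scrambleNumber = 16 ∧
    (SimpleGraph.hypercube 5).gonality = 16 ∧
    (SimpleGraph.foldedCube 5).scrambleNumber = 16 ∧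
    (SimpleGraph.foldedCube 5).gonality = 16 := by
  have hadj : ∀ v ∈ oddVertices, (hypercube 5).Adj v (Function.update v 0 (!v 0)) :=
    fun v _ => hypercube_adj_update v 0
  have hle := hypercube_le_foldedCube 5
  have hindep : (hypercube 5).IsIndepSet (oddVertices : Set (Fin 5 → Bool)) :=
    fun x hx y hy hxy h => isIndepSet_oddVertices_foldedCube hx hy hxy (hle h)
  have hsn : 16 ≤ (hypercube 5).scrambleNumber :=
    sixteen_le_order_uniformScramble.trans
      (le_iSup (fun S : (hypercube 5).Scramble => S.order) _)
  obtain ⟨h1, h2⟩ := scrambleNumber_eq_and_gonality_eq (n := 16) hsn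
    ((hypercube 5).divisorRank_pos_of_isIndepSet oddVertices hindep fun v hv => ⟨_, hadj v hv⟩)
    divisorDegree_oddVertices_compl
  obtain ⟨h3, h4⟩ := scrambleNumber_eq_and_gonality_eq (n := 16)
    (hsn.trans (scrambleNumber_mono hle))
    ((foldedCube 5).divisorRank_pos_of_isIndepSet oddVertices isIndepSet_oddVertices_foldedCube
      fun v hv => ⟨_, hle (hadj v hv)⟩)
    divisorDegree_oddVertices_compl
  refine ⟨le_antisymm ?_ sixteen_le_order_uniformScramble, h1, h2, h3, h4⟩
  exact (le_iSup (fun S : (hypercube 5).Scramble => S.order) _).trans h1.le
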